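/- All graphs are finite, simple and undirected, and are counted up to isomorphism. For a graph $G$ let $\chi(G)$ denote its chromatic number, and for a vertex $v$ of $G$ let $G-v$ be the graph obtained by deleting $v$. A graph $G$ is \emph{$k$-vertex-critical} if $\chi(G)=k$ and $\chi(G-v)<k$ for every vertex $v$ of $G$; it is \emph{$H$-free} if it has no induced subgraph isomorphic to $H$. Let $\overline{K_4}$ be the graph with four vertices and no edges, let $P_t$ be the path on $t$ vertices, and let $+$ denote disjoint union, with $2P_1=P_1+P_1$. Let $H$ be a graph with at most four vertices, and let $k\ge 5$ be an integer. Then there are only finitely many $k$-vertex-critical $H$-free graphs if and only if $H$ is isomorphic to an induced subgraph of at least one of $\overline{K_4}$, $P_4$, $P_2+2P_1$, $P_3+P_1$. -/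

import Mathlib

open scoped SimpleGraph

/-- `G` is `k`-vertex-critical: `χ(G) = k`, and `χ(G - v) < k` for every vertex `v`. -/
def IsVertexCritical {V : Type*} (G : SimpleGraph V) (k : ℕ) : Prop :=
  G.chromaticNumber = (k : ℕ∞) ∧ ∀ v : V, (G.induce {v}ᶜ).chromaticNumber < (k : ℕ∞)

/-- `G` is `H`-free: it does not contain `H` as an induced subgraph. -/
def IsInducedFree {V W : Type*} (H : SimpleGraph V) (G : SimpleGraph W) : Prop :=
  ¬ H ⊴ G

/-- Finite simple graphs on the vertex sets `{0, …, n - 1}`, identified when isomorphic. -/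
def graphIsoSetoid : Setoid (Σ n : ℕ, SimpleGraph (Fin n)) where
  r G G' := Nonempty (G.2 ≃g G'.2)
  iseqv :=
    { refl := fun _ => ⟨SimpleGraph.Iso.refl⟩
      symm := fun ⟨f⟩ => ⟨f.symm⟩
      trans := fun ⟨f⟩ ⟨g⟩ => ⟨g.comp f⟩ }

/-- The isomorphism classes of finite simple graphs. -/
def GraphIsoClass : Type := Quotient graphIsoSetoid

/-- The isomorphism class of a graph on `{0, …, n - 1}`. -/
def graphIsoClass {n : ℕ} (G : SimpleGraph (Fin n)) : GraphIsoClass :=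
  Quotient.mk graphIsoSetoid ⟨n, G⟩

/-- The isomorphism classes of the finite `k`-vertex-critical `H`-free graphs. -/
def criticalFreeClasses {V : Type*} (k : ℕ) (H : SimpleGraph V) : Set GraphIsoClass :=
  {c | ∃ (n : ℕ) (G : SimpleGraph (Fin n)),
    IsVertexCritical G k ∧ IsInducedFree H G ∧ graphIsoClass G = c}

/-!
If `H` contains a triangle, a square, a claw or `2P₂` as an induced subgraph, then graphs free of
that subgraph are `H`-free, so it suffices to find arbitrarily large critical graphs avoiding each
of these four. With `n = mp + 1`, the `(m - 1)`-st power of the `n`-cycle is not `m`-colourable: it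
is a circulant graph with an `m`-clique, and a clique and an independent set of a circulant graph
have product of sizes at most `n`, so an `m`-colouring would force `m ∣ n`. Multiplication by `p`
maps it injectively into the complement of the `(p - 1)`-st power, which becomes `m`-colourable once
a vertex is deleted. Hence both graphs are `(m + 1)`-vertex-critical. Powers of long cycles contain
no claw and no induced square, their complements contain no induced `2P₂`, and odd cycles yield
triangle-free critical graphs of every larger chromatic number by Mycielski's construction. The
graphs on at most four vertices avoiding all four subgraphs are the induced subgraphs of `4P₁`,
`P₄`, `P₂ + 2P₁` and `P₃ + P₁`.

Conversely a `k`-vertex-critical graph with independence number at most `α` has at most `αk`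
vertices, which settles `4P₁`. If it is `P₂ + 2P₁`-free, deleting a vertex `v` of an independent set
of size `k + 1` leaves two vertices of that set in one colour class, and a neighbour of `v` in that
class completes an induced `P₂ + 2P₁`. A `P₄`-free graph is perfect, so a critical one is complete.
If it is `P₃ + P₁`-free and `S` is a maximal independent set of size at least three, the private
neighbourhoods of the points of `S` are disjoint cliques with the same neighbours elsewhere, so the
smaller of two of them can be folded into the larger, contradicting criticality.
-/

open SimpleGraph

section

variable {V W U : Type*} {G : SimpleGraph V} {H : SimpleGraph W} {n m k : ℕ} {v : V}

theorem exists_coloring_option_of_induce_compl {s : Set V} (hs : G.IsIndepSet s)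
    (h : (G.induce sᶜ).Colorable n) :
    ∃ C : G.Coloring (Option (Fin n)), ∀ x, C x = none ↔ x ∈ s := by
  classical
  obtain ⟨C⟩ := h
  refine ⟨Coloring.mk (fun x => if hx : x ∈ s then none else some (C ⟨x, hx⟩))
    fun {x y} hxy => ?_, fun x => ?_⟩
  · by_cases hx : x ∈ s <;> by_cases hy : y ∈ s
    · exact absurd hxy (hs hx hy hxy.ne)
    · simp [hx, hy]
    · simp [hx, hy]
    · simpa [hx, hy] using C.valid (v := ⟨x, hx⟩) (w := ⟨y, hy⟩) hxy
  · change (if hx : x ∈ s then none else some (C ⟨x, hx⟩)) = none ↔ x ∈ s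
    by_cases hx : x ∈ s <;> simp [hx]

theorem colorable_succ_of_induce_compl {s : Set V} (hs : G.IsIndepSet s)
    (h : (G.induce sᶜ).Colorable n) : G.Colorable (n + 1) := by
  obtain ⟨C, -⟩ := exists_coloring_option_of_induce_compl hs h
  simpa using C.colorable

theorem isVertexCritical_succ_iff : IsVertexCritical G (n + 1) ↔
    ¬ G.Colorable n ∧ ∀ v, (G.induce {v}ᶜ).Colorable n := by
  have hlt (v : V) : (G.induce {v}ᶜ).chromaticNumber < (n : ℕ∞) + 1 ↔
      (G.induce {v}ᶜ).Colorable n := by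
    rw [← chromaticNumber_le_iff_colorable, ENat.lt_add_one_iff (ENat.natCast_ne_top n)]
  simp only [IsVertexCritical, Nat.cast_add_one, hlt,
    chromaticNumber_eq_iff_colorable_not_colorable]
  refine ⟨fun h => ⟨h.1.2, h.2⟩, fun ⟨hG, hdel⟩ => ⟨⟨?_, hG⟩, hdel⟩⟩
  cases isEmpty_or_nonempty V with
  | inl _ => exact .of_isEmpty ..
  | inr hV =>
    obtain ⟨v⟩ := hV
    exact colorable_succ_of_induce_compl (Set.pairwise_singleton v _) (hdel v)

theorem exists_adj_color_eq (hG : ¬ G.Colorable n) (C : (G.induce {v}ᶜ).Coloring (Fin n))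
    (i : Fin n) : ∃ u : ({v}ᶜ : Set V), G.Adj v u ∧ C u = i := by
  classical
  by_contra! h
  refine hG ⟨Coloring.mk (fun x => if hx : x ∈ ({v}ᶜ : Set V) then C ⟨x, hx⟩ else i)
    fun {x y} hxy => ?_⟩
  by_cases hx : x = v <;> by_cases hy : y = v
  · exact absurd (hx.trans hy.symm) hxy.ne
  · simpa [hx, hy] using (h ⟨y, hy⟩ (hx ▸ hxy)).symm
  · simpa [hx, hy] using h ⟨x, hx⟩ (hy ▸ hxy.symm)
  · simpa [hx, hy] using C.valid (v := ⟨x, hx⟩) (w := ⟨y, hy⟩) hxy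

namespace IsVertexCritical

theorem surjective_of_endomorphism (hG : IsVertexCritical G k) (f : G →g G) :
    Function.Surjective f := by
  intro v
  by_contra! hv
  let g : G →g G.induce {v}ᶜ := ⟨fun x => ⟨f x, hv x⟩, fun h => f.map_adj h⟩
  have hle : G.chromaticNumber ≤ (G.induce {v}ᶜ).chromaticNumber := chromaticNumber_mono_of_hom g
  exact absurd (hG.2 v) (hG.1 ▸ hle).not_gt

theorem of_iso (hG : IsVertexCritical G k) (e : G ≃g H) : IsVertexCritical H k := by
  have hχ : H.chromaticNumber = G.chromaticNumber :=
    (chromaticNumber_mono_of_hom e.symm.toHom).antisymm (chromaticNumber_mono_of_hom e.toHom)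
  refine ⟨hχ.trans hG.1, fun w => ?_⟩
  let g : H.induce {w}ᶜ →g G.induce {e.symm w}ᶜ :=
    ⟨fun x => ⟨e.symm x, fun h => x.2 (e.symm.injective h)⟩, fun h => e.symm.map_adj_iff.2 h⟩
  exact (chromaticNumber_mono_of_hom g).trans_lt (hG.2 _)

end IsVertexCritical

/-- The number of vertices of the graphs in an isomorphism class; a set of classes is finite
exactly when their orders are bounded. -/
def GraphIsoClass.order : GraphIsoClass → ℕ :=
  Quotient.lift Sigma.fst fun _ _ ⟨e⟩ => by simpa using Fintype.card_congr e.toEquiv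

theorem GraphIsoClass.finite_order_le (N : ℕ) : {c : GraphIsoClass | c.order ≤ N}.Finite := by
  let toClass : (Σ n : Fin (N + 1), SimpleGraph (Fin n)) → GraphIsoClass :=
    fun x => graphIsoClass x.2
  refine (Set.finite_range toClass).subset ?_
  rintro ⟨n, G⟩ (hn : n ≤ N)
  exact ⟨⟨⟨n, Nat.lt_succ_of_le hn⟩, G⟩, rfl⟩

theorem criticalFreeClasses_finite_iff : (criticalFreeClasses k H).Finite ↔
    ∃ N, ∀ (V : Type) [Fintype V] (G : SimpleGraph V),
      IsVertexCritical G k → IsInducedFree H G → Fintype.card V ≤ N := by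
  constructor
  · intro hfin
    obtain ⟨N, hN⟩ := (hfin.image GraphIsoClass.order).bddAbove
    refine ⟨N, fun V _ G hcrit hfree => hN ⟨_, ⟨_, G.overFin rfl, ?_, ?_, rfl⟩, rfl⟩⟩
    · exact hcrit.of_iso (G.overFinIso rfl)
    · exact fun h => hfree (h.trans (G.overFinIso rfl).symm.isIndContained)
  · rintro ⟨N, hN⟩
    refine (GraphIsoClass.finite_order_le N).subset ?_
    rintro _ ⟨n, G, hcrit, hfree, rfl⟩
    exact (Fintype.card_fin n).ge.trans (hN (Fin n) G hcrit hfree)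

theorem criticalFreeClasses_mono {T : SimpleGraph U} (h : T ⊴ H) :
    criticalFreeClasses k T ⊆ criticalFreeClasses k H :=
  fun _ ⟨n, G, hcrit, hfree, hc⟩ => ⟨n, G, hcrit, fun hH => hfree (h.trans hH), hc⟩

section InducedSubgraphs

variable {a b c d : V}

theorem isIndContained_of_trichotomous {T : SimpleGraph W} (r : W → W → Prop)
    [Std.Trichotomous r] (f : W → V)
    (h : ∀ i j, r i j → f i ≠ f j ∧ (G.Adj (f i) (f j) ↔ T.Adj i j)) : T ⊴ G := by
  have hinj : Function.Injective f := fun i j hij => by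
    rcases trichotomous_of r i j with hr | rfl | hr
    exacts [absurd hij (h i j hr).1, rfl, absurd hij.symm (h j i hr).1]
  refine ⟨⟨⟨f, hinj⟩, fun {i j} => ?_⟩⟩
  change G.Adj (f i) (f j) ↔ T.Adj i j
  rcases trichotomous_of r i j with hr | rfl | hr
  · exact (h i j hr).2
  · simp
  · rw [G.adj_comm, T.adj_comm, (h j i hr).2]

theorem pathGraph_four_isIndContained (hab : G.Adj a b) (hbc : G.Adj b c) (hcd : G.Adj c d)
    (hac : ¬ G.Adj a c) (had : ¬ G.Adj a d) (hbd : ¬ G.Adj b d) : pathGraph 4 ⊴ G := by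
  have hac' : a ≠ c := fun h => had (h ▸ hcd)
  have hbd' : b ≠ d := fun h => had (h ▸ hab)
  have had' : a ≠ d := fun h => hac (h ▸ hcd.symm)
  refine isIndContained_of_trichotomous (· < ·) ![a, b, c, d] ?_
  simp [Fin.forall_fin_succ, pathGraph_adj, hab.ne, hbc.ne, hcd.ne, *]

theorem pathGraph_three_sum_isIndContained (hab : G.Adj a b) (hbc : G.Adj b c) (hne : a ≠ c)
    (hac : ¬ G.Adj a c) (had : ¬ G.Adj a d) (hbd : ¬ G.Adj b d) (hcd : ¬ G.Adj c d) :
    pathGraph 3 ⊕g pathGraph 1 ⊴ G := by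
  have had' : a ≠ d := fun h => hbd (h ▸ hab.symm)
  have hbd' : b ≠ d := fun h => had (h ▸ hab)
  have hcd' : c ≠ d := fun h => hbd (h ▸ hbc)
  refine isIndContained_of_trichotomous (Sum.Lex (· < ·) (· < ·)) (Sum.elim ![a, b, c] ![d]) ?_
  simp [Fin.forall_fin_succ, pathGraph_adj, hab.ne, hbc.ne, *]

theorem pathGraph_two_sum_isIndContained (hab : G.Adj a b) (hne : c ≠ d) (hcd : ¬ G.Adj c d)
    (hac : ¬ G.Adj a c) (had : ¬ G.Adj a d) (hbc : ¬ G.Adj b c) (hbd : ¬ G.Adj b d) :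
    pathGraph 2 ⊕g (pathGraph 1 ⊕g pathGraph 1) ⊴ G := by
  have hac' : a ≠ c := fun h => hbc (h ▸ hab.symm)
  have had' : a ≠ d := fun h => hbd (h ▸ hab.symm)
  have hbc' : b ≠ c := fun h => hac (h ▸ hab)
  have hbd' : b ≠ d := fun h => had (h ▸ hab)
  refine isIndContained_of_trichotomous (Sum.Lex (· < ·) (Sum.Lex (· < ·) (· < ·)))
    (Sum.elim ![a, b] (Sum.elim ![c] ![d])) ?_
  simp [Fin.forall_fin_succ, pathGraph_adj, hab.ne, *]

theorem pathGraph_two_sum_pathGraph_two_isIndContained (hab : G.Adj a b) (hcd : G.Adj c d)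
    (hac : ¬ G.Adj a c) (had : ¬ G.Adj a d) (hbc : ¬ G.Adj b c) (hbd : ¬ G.Adj b d) :
    pathGraph 2 ⊕g pathGraph 2 ⊴ G := by
  have hac' : a ≠ c := fun h => had (h ▸ hcd)
  have had' : a ≠ d := fun h => hac (h ▸ hcd.symm)
  have hbc' : b ≠ c := fun h => hbd (h ▸ hcd)
  have hbd' : b ≠ d := fun h => hbc (h ▸ hcd.symm)
  refine isIndContained_of_trichotomous (Sum.Lex (· < ·) (· < ·)) (Sum.elim ![a, b] ![c, d]) ?_
  simp [Fin.forall_fin_succ, pathGraph_adj, hab.ne, hcd.ne, *]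

theorem cycleGraph_four_isIndContained_iff : cycleGraph 4 ⊴ G ↔ ∃ a b c d, a ≠ c ∧ b ≠ d ∧
    G.Adj a b ∧ G.Adj b c ∧ G.Adj c d ∧ G.Adj d a ∧ ¬ G.Adj a c ∧ ¬ G.Adj b d := by
  constructor
  · rintro ⟨f⟩
    refine ⟨f 0, f 1, f 2, f 3, f.injective.ne (by decide), f.injective.ne (by decide), ?_⟩
    simp only [f.map_adj_iff]
    decide
  · rintro ⟨a, b, c, d, hac, hbd, hab, hbc, hcd, hda, hac', hbd'⟩
    have hadj : ∀ i j, (cycleGraph 4).Adj i j ↔ i + 1 = j ∨ j + 1 = i := by decide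
    refine isIndContained_of_trichotomous (· < ·) ![a, b, c, d] ?_
    simp [Fin.forall_fin_succ, hab.ne, hbc.ne, hcd.ne, hda.ne', hda.symm, *]

theorem starGraph_isIndContained_iff : starGraph (0 : Fin 4) ⊴ G ↔ ∃ d a b c,
    G.Adj d a ∧ G.Adj d b ∧ G.Adj d c ∧ a ≠ b ∧ a ≠ c ∧ b ≠ c ∧
    ¬ G.Adj a b ∧ ¬ G.Adj a c ∧ ¬ G.Adj b c := by
  constructor
  · rintro ⟨f⟩
    refine ⟨f 0, f 1, f 2, f 3, ?_⟩
    simp only [f.map_adj_iff, f.injective.ne_iff]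
    simp
  · rintro ⟨d, a, b, c, hda, hdb, hdc, hab, hac, hbc, hab', hac', hbc'⟩
    refine isIndContained_of_trichotomous (· < ·) ![d, a, b, c] ?_
    simp [Fin.forall_fin_succ, hda.ne, hdb.ne, hdc.ne, *]

theorem isInducedFree_completeGraph_iff :
    IsInducedFree (completeGraph (Fin n)) G ↔ G.CliqueFree n := by
  rw [IsInducedFree, completeGraph_eq_top, top_isIndContained_iff_top_isContained,
    ← not_cliqueFree_iff_top_isContained, not_not]

theorem isInducedFree_compl_completeGraph_iff :
    IsInducedFree (completeGraph (Fin n))ᶜ G ↔ G.IndepSetFree n := by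
  rw [← cliqueFree_compl, ← isInducedFree_completeGraph_iff, IsInducedFree, IsInducedFree,
    ← compl_isIndContained_compl, compl_compl]

end InducedSubgraphs

theorem card_le_of_colorable_of_indepSetFree [Fintype V] {α : ℕ} (hG : G.Colorable k)
    (hα : G.IndepSetFree (α + 1)) : Fintype.card V ≤ α * k := by
  classical
  obtain ⟨C⟩ := hG
  have hfiber (i : Fin k) : (Finset.univ.filter (C · = i)).card ≤ α := by
    by_contra! hlt
    obtain ⟨s, hs, hcard⟩ := Finset.exists_subset_card_eq hlt
    refine hα s ⟨(C.isIndepSet_colorClass i).mono fun x hx => ?_, hcard⟩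
    exact (Finset.mem_filter.1 (hs hx)).2
  simpa using Finset.card_le_mul_card_image_of_maps_to (f := C) (s := .univ) (t := .univ)
    (fun _ _ => Finset.mem_univ _) α fun i _ => hfiber i

theorem IsVertexCritical.colorable (hG : IsVertexCritical G k) : G.Colorable k :=
  chromaticNumber_le_iff_colorable.1 hG.1.le

theorem finite_criticalFreeClasses_of_indepSetFree (α : ℕ)
    (h : ∀ (V : Type) [Finite V] (G : SimpleGraph V), IsVertexCritical G k → IsInducedFree H G →
      G.IndepSetFree (α + 1)) : (criticalFreeClasses k H).Finite :=
  criticalFreeClasses_finite_iff.2 ⟨α * k, fun V _ G hcrit hfree =>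
    card_le_of_colorable_of_indepSetFree hcrit.colorable (h V G hcrit hfree)⟩

theorem finite_criticalFreeClasses_compl_completeGraph (n k : ℕ) :
    (criticalFreeClasses k (completeGraph (Fin (n + 1)))ᶜ).Finite :=
  finite_criticalFreeClasses_of_indepSetFree n fun _ _ _ _ hfree =>
    isInducedFree_compl_completeGraph_iff.1 hfree

theorem IsVertexCritical.indepSetFree_of_isInducedFree (hG : IsVertexCritical G k)
    (hfree : IsInducedFree (pathGraph 2 ⊕g (pathGraph 1 ⊕g pathGraph 1)) G) :
    G.IndepSetFree (k + 1) := by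
  classical
  rintro s ⟨hs, hcard⟩
  obtain ⟨v, hv⟩ : s.Nonempty := Finset.card_pos.1 (by omega)
  obtain _ | n := k
  · exact absurd (hG.2 v) (by simp)
  obtain ⟨hχ, hdel⟩ := isVertexCritical_succ_iff.1 hG
  obtain ⟨C⟩ := hdel v
  let t : Finset ({v}ᶜ : Set V) := (s.erase v).subtype (· ∈ ({v}ᶜ : Set V))
  have ht : (Finset.univ : Finset (Fin n)).card < t.card := by
    have hmem : ∀ x ∈ s.erase v, x ∈ ({v}ᶜ : Set V) := fun _ hx => Finset.ne_of_mem_erase hx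
    rw [Finset.card_subtype, Finset.filter_true_of_mem hmem, Finset.card_erase_of_mem hv,
      Finset.card_fin]
    omega
  obtain ⟨x, hx, y, hy, hxy, hC⟩ :=
    Finset.exists_ne_map_eq_of_card_lt_of_maps_to ht (f := C) fun _ _ => Finset.mem_univ _
  obtain ⟨z, hvz, hz⟩ := exists_adj_color_eq hχ C (C x)
  have hxs : (x : V) ∈ s := Finset.mem_of_mem_erase (Finset.mem_subtype.1 hx)
  have hys : (y : V) ∈ s := Finset.mem_of_mem_erase (Finset.mem_subtype.1 hy)
  have hxy' : (x : V) ≠ y := Subtype.coe_ne_coe.2 hxy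
  have hzx : ¬ G.Adj z x := fun h => C.valid (v := z) (w := x) h hz
  have hzy : ¬ G.Adj z y := fun h => C.valid (v := z) (w := y) h (hz.trans hC)
  exact hfree (pathGraph_two_sum_isIndContained hvz hxy' (hs hxs hys hxy')
    (hs hv hxs (Ne.symm x.2)) (hs hv hys (Ne.symm y.2)) hzx hzy)

theorem finite_criticalFreeClasses_pathGraph_two_sum (k : ℕ) :
    (criticalFreeClasses k (pathGraph 2 ⊕g (pathGraph 1 ⊕g pathGraph 1))).Finite :=
  finite_criticalFreeClasses_of_indepSetFree k fun _ _ _ hG hfree =>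
    hG.indepSetFree_of_isInducedFree hfree

section MaximalIndepSet

variable {s : Set V}

theorem exists_maximal_isIndepSet_superset (hs : G.IsIndepSet s) :
    ∃ t, s ⊆ t ∧ Maximal G.IsIndepSet t := by
  refine zorn_subset_nonempty {t | G.IsIndepSet t} (fun c hc hchain _ => ?_) s hs
  exact ⟨⋃₀ c, (Set.pairwise_sUnion hchain.directedOn).2 hc,
    fun t ht => Set.subset_sUnion_of_mem ht⟩

theorem exists_adj_of_maximal_isIndepSet (hs : Maximal G.IsIndepSet s) (hv : v ∉ s) :
    ∃ x ∈ s, G.Adj v x := by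
  by_contra! h
  have hins : G.IsIndepSet (insert v s) :=
    hs.1.insert fun x hx _ => ⟨h x hx, fun hxv => h x hx hxv.symm⟩
  exact hv (hs.2 hins (Set.subset_insert v s) (Set.mem_insert v s))

end MaximalIndepSet

section PathFour

-- Choose `x` with as many neighbours in `t` as possible. If `y` in `t` were not a neighbour of `x`,
-- a neighbour `w` of `y` in `s` would miss some neighbour `z` of `x` in `t`, and `x - z - y - w`
-- would be an induced path.
theorem exists_mem_forall_adj_of_isClique (hfree : IsInducedFree (pathGraph 4) G) {s : Set V}
    (hs : Maximal G.IsIndepSet s) {t : Finset V} (ht : G.IsClique t) (hne : t.Nonempty)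
    (hst : ∀ y ∈ t, y ∉ s) : ∃ x ∈ s, ∀ y ∈ t, G.Adj x y := by
  classical
  obtain ⟨x₀, hx₀, -⟩ := exists_adj_of_maximal_isIndepSet hs (hst _ hne.choose_spec)
  obtain ⟨x, hx, hmax⟩ := Set.Finite.exists_maximalFor' (fun x => t.filter (G.Adj x)) s
    (t.powerset.finite_toSet.subset <| Set.image_subset_iff.2 fun _ _ =>
      Finset.mem_powerset.2 (Finset.filter_subset _ t)) ⟨x₀, hx₀⟩
  refine ⟨x, hx, fun y hy => by_contra fun hxy => ?_⟩
  obtain ⟨w, hw, hyw⟩ := exists_adj_of_maximal_isIndepSet hs (hst y hy)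
  obtain ⟨z, hz, hz'⟩ : ∃ z ∈ t.filter (G.Adj x), z ∉ t.filter (G.Adj w) := by
    refine Finset.not_subset.1 fun hle => hxy ?_
    exact (Finset.mem_filter.1 (hmax hw hle (Finset.mem_filter.2 ⟨hy, hyw.symm⟩))).2
  obtain ⟨hzt, hxz⟩ := Finset.mem_filter.1 hz
  have hwz : ¬ G.Adj w z := fun h => hz' (Finset.mem_filter.2 ⟨hzt, h⟩)
  have hzy : G.Adj z y := ht hzt hy fun h => hxy (h ▸ hxz)
  have hxw : ¬ G.Adj x w := hs.1 hx hw fun h => hxy (h ▸ hyw.symm)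
  exact hfree (pathGraph_four_isIndContained hxz hzy hyw hxy hxw fun h => hwz h.symm)

theorem cliqueFree_induce_compl_of_maximal_isIndepSet (hfree : IsInducedFree (pathGraph 4) G)
    {s : Set V} (hs : Maximal G.IsIndepSet s) (hn : n ≠ 0) (hG : G.CliqueFree (n + 1)) :
    (G.induce sᶜ).CliqueFree n := by
  classical
  intro t ht
  rw [isNClique_induce_iff] at ht
  obtain ⟨x, -, hx⟩ := exists_mem_forall_adj_of_isClique hfree hs ht.isClique
    (Finset.card_ne_zero.1 (ht.card_eq.trans_ne hn)) (by simp +contextual)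
  exact hG _ (ht.insert hx)

theorem colorable_of_cliqueFree (hfree : IsInducedFree (pathGraph 4) G)
    (hG : G.CliqueFree (n + 1)) : G.Colorable n := by
  induction n generalizing V with
  | zero =>
    have := cliqueFree_one.1 hG
    exact .of_isEmpty ..
  | succ n ih =>
    obtain ⟨s, -, hs⟩ := exists_maximal_isIndepSet_superset (G := G) (s := ∅) (by simp)
    refine colorable_succ_of_induce_compl hs.1 (ih ?_ ?_)
    · exact fun h => hfree (h.trans ⟨Embedding.induce _⟩)
    · exact cliqueFree_induce_compl_of_maximal_isIndepSet hfree hs n.succ_ne_zero hG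

theorem IsVertexCritical.card_le_of_not_cliqueFree [Fintype V] (hG : IsVertexCritical G k)
    (hclique : ¬ G.CliqueFree k) : Fintype.card V ≤ k := by
  obtain ⟨C⟩ := hG.colorable
  let f : G →g G := (topEmbeddingOfNotCliqueFree hclique).toHom.comp C
  have hf : Function.Surjective f := hG.surjective_of_endomorphism f
  have := Fintype.card_le_of_surjective (topEmbeddingOfNotCliqueFree hclique) (hf.of_comp (g := C))
  simpa using this

theorem finite_criticalFreeClasses_pathGraph_four (k : ℕ) :
    (criticalFreeClasses k (pathGraph 4)).Finite := by
  refine criticalFreeClasses_finite_iff.2 ⟨k, fun V _ G hG hfree => ?_⟩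
  refine hG.card_le_of_not_cliqueFree fun hclique => ?_
  obtain _ | n := k
  · exact not_cliqueFree_zero hclique
  · exact (isVertexCritical_succ_iff.1 hG).1 (colorable_of_cliqueFree hfree hclique)

end PathFour

section PathThreeSum

/-- The private neighbourhood of `t` in `S`: the vertices whose closed neighbourhood meets `S` in
`{t}` only. For a maximal independent set `S` with at least three vertices in a `P₃ + P₁`-free
graph, these sets are cliques and the smaller of two can be folded into the larger. -/
def privateNeighbors (G : SimpleGraph V) (S : Set V) (t : V) : Set V :=
  {v | ∀ r ∈ S, (v = r ∨ G.Adj v r) ↔ r = t}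

variable {S : Set V} {s t w : V}

theorem self_mem_privateNeighbors (hS : G.IsIndepSet S) (ht : t ∈ S) :
    t ∈ privateNeighbors G S t := by
  refine fun r hr => ⟨?_, fun h => .inl h.symm⟩
  rintro (rfl | hadj)
  exacts [rfl, by_contra fun hne => hS ht hr (Ne.symm hne) hadj]

theorem ne_and_not_adj_of_mem_privateNeighbors (hv : v ∈ privateNeighbors G S t) (hs : s ∈ S)
    (hst : s ≠ t) : v ≠ s ∧ ¬ G.Adj v s :=
  not_or.1 fun h => hst ((hv s hs).1 h)

theorem exists_mem_ne_ne (hS : 2 < S.encard) (s t : V) : ∃ u ∈ S, u ≠ s ∧ u ≠ t := by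
  by_contra! h
  have hsub : S ⊆ {s, t} := fun u hu => by
    by_cases hus : u = s
    exacts [.inl hus, .inr (h u hu hus)]
  refine hS.not_ge ((Set.encard_le_encard hsub).trans ?_)
  exact (Set.encard_insert_le _ _).trans (by simp [one_add_one_eq_two])

section

variable (hfree : IsInducedFree (pathGraph 3 ⊕g pathGraph 1) G)
include hfree

theorem mem_privateNeighbors_or_forall_adj (hS : Maximal G.IsIndepSet S) (v : V) :
    (∃ t ∈ S, v ∈ privateNeighbors G S t) ∨ ∀ r ∈ S, G.Adj v r := by
  by_cases hv : v ∈ S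
  · exact .inl ⟨v, hv, self_mem_privateNeighbors hS.1 hv⟩
  obtain ⟨t, ht, hvt⟩ := exists_adj_of_maximal_isIndepSet hS hv
  by_cases hr : ∃ r ∈ S, r ≠ t ∧ G.Adj v r
  · obtain ⟨r, hr, hrt, hvr⟩ := hr
    refine .inr fun u hu => by_contra fun hvu => hfree ?_
    have hur : u ≠ r := fun h => hvu (h ▸ hvr)
    have hut : u ≠ t := fun h => hvu (h ▸ hvt)
    exact pathGraph_three_sum_isIndContained hvr.symm hvt hrt (hS.1 hr ht hrt)
      (hS.1 hr hu hur.symm) hvu (hS.1 ht hu hut.symm)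
  · refine .inl ⟨t, ht, fun r hr' => ⟨?_, fun h => .inr (h ▸ hvt)⟩⟩
    rintro (rfl | hadj)
    exacts [absurd hr' hv, by_contra fun hrt => hr ⟨r, hr', hrt, hadj⟩]

theorem isClique_privateNeighbors (hS : G.IsIndepSet S) (hcard : 2 < S.encard) (ht : t ∈ S) :
    G.IsClique (privateNeighbors G S t) := by
  intro v hv w hw hvw
  obtain ⟨u, hu, hut, -⟩ := exists_mem_ne_ne hcard t t
  have hvu := (ne_and_not_adj_of_mem_privateNeighbors hv hu hut).2
  have hwu := (ne_and_not_adj_of_mem_privateNeighbors hw hu hut).2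
  rcases (hv t ht).2 rfl with rfl | hvt
  · exact ((hw v ht).2 rfl).resolve_left hvw.symm |>.symm
  rcases (hw t ht).2 rfl with rfl | hwt
  · exact hvt
  by_contra hvw'
  exact hfree (pathGraph_three_sum_isIndContained hvt hwt.symm hvw hvw' hvu
    (hS ht hu hut.symm) hwu)

theorem not_adj_of_mem_privateNeighbors (hS : G.IsIndepSet S) (hcard : 2 < S.encard)
    (hs : s ∈ S) (hst : s ≠ t) (hv : v ∈ privateNeighbors G S s)
    (hw : w ∈ privateNeighbors G S t) : ¬ G.Adj v w := by
  intro hvw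
  obtain ⟨u, hu, hus, hut⟩ := exists_mem_ne_ne hcard s t
  have hws := ne_and_not_adj_of_mem_privateNeighbors hw hs hst
  have hvu := (ne_and_not_adj_of_mem_privateNeighbors hv hu hus).2
  have hwu := (ne_and_not_adj_of_mem_privateNeighbors hw hu hut).2
  have hsv : G.Adj s v := by
    rcases (hv s hs).2 rfl with rfl | hvs
    exacts [absurd hvw.symm hws.2, hvs.symm]
  exact hfree (pathGraph_three_sum_isIndContained hsv hvw hws.1.symm
    (fun h => hws.2 h.symm) (hS hs hu hus.symm) hvu hwu)

theorem adj_of_forall_adj_of_mem_privateNeighbors (hS : G.IsIndepSet S) (hcard : 2 < S.encard)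
    (hw : ∀ r ∈ S, G.Adj w r) (hv : v ∈ privateNeighbors G S t) : G.Adj w v := by
  obtain ⟨r, hr, hrt, -⟩ := exists_mem_ne_ne hcard t t
  obtain ⟨u, hu, hur, hut⟩ := exists_mem_ne_ne hcard r t
  have hvr := (ne_and_not_adj_of_mem_privateNeighbors hv hr hrt).2
  have hvu := (ne_and_not_adj_of_mem_privateNeighbors hv hu hut).2
  by_contra hwv
  exact hfree (pathGraph_three_sum_isIndContained (hw r hr).symm (hw u hu) hur.symm
    (hS hr hu hur.symm) (fun h => hvr h.symm) hwv fun h => hvu h.symm)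

-- Folding `privateNeighbors G S s` into `privateNeighbors G S t` is an endomorphism of `G`.
theorem exists_hom_forall_ne_of_embedding (hS : Maximal G.IsIndepSet S) (hcard : 2 < S.encard)
    (hs : s ∈ S) (ht : t ∈ S) (hst : s ≠ t)
    (φ : privateNeighbors G S s ↪ privateNeighbors G S t) : ∃ f : G →g G, ∀ x, f x ≠ s := by
  classical
  have hφ {x y} (hx : x ∈ privateNeighbors G S s) (hy : y ∉ privateNeighbors G S s)
      (hxy : G.Adj x y) : G.Adj (φ ⟨x, hx⟩) y := by
    rcases mem_privateNeighbors_or_forall_adj hfree hS y with ⟨r, -, hyr⟩ | hadj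
    · have hsr : s ≠ r := fun h => hy (h ▸ hyr)
      exact absurd hxy (not_adj_of_mem_privateNeighbors hfree hS.1 hcard hs hsr hx hyr)
    · exact (adj_of_forall_adj_of_mem_privateNeighbors hfree hS.1 hcard hadj (φ _).2).symm
  refine ⟨⟨fun x => if hx : x ∈ privateNeighbors G S s then φ ⟨x, hx⟩ else x,
    fun {x y} hxy => ?_⟩, fun x => ?_⟩
  · by_cases hx : x ∈ privateNeighbors G S s <;> by_cases hy : y ∈ privateNeighbors G S s
    · have hne : φ ⟨x, hx⟩ ≠ φ ⟨y, hy⟩ := φ.injective.ne (by simpa using hxy.ne)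
      simpa [hx, hy] using isClique_privateNeighbors hfree hS.1 hcard ht (φ _).2 (φ _).2
        (Subtype.coe_ne_coe.2 hne)
    · simpa [hx, hy] using hφ hx hy hxy
    · simpa [hx, hy] using (hφ hy hx hxy.symm).symm
    · simpa [hx, hy] using hxy
  · by_cases hx : x ∈ privateNeighbors G S s
    · simpa [hx] using (ne_and_not_adj_of_mem_privateNeighbors (φ ⟨x, hx⟩).2 hs hst).1
    · simpa [hx] using (ne_of_mem_of_not_mem (self_mem_privateNeighbors hS.1 hs) hx).symm

end

theorem IsVertexCritical.indepSetFree_three (hG : IsVertexCritical G k)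
    (hfree : IsInducedFree (pathGraph 3 ⊕g pathGraph 1) G) : G.IndepSetFree 3 := by
  rintro A ⟨hA, hcardA⟩
  obtain ⟨S, hAS, hS⟩ := exists_maximal_isIndepSet_superset hA
  have hcard : 2 < S.encard := by
    refine lt_of_lt_of_le ?_ (Set.encard_le_encard hAS)
    rw [Set.encard_coe_eq_coe_finsetCard, hcardA]
    norm_num
  have hempty {s t : V} (hs : s ∈ S) (ht : t ∈ S) (hst : s ≠ t) :
      IsEmpty (privateNeighbors G S s ↪ privateNeighbors G S t) := by
    refine ⟨fun φ => ?_⟩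
    obtain ⟨f, hf⟩ := exists_hom_forall_ne_of_embedding hfree hS hcard hs ht hst φ
    obtain ⟨x, hx⟩ := hG.surjective_of_endomorphism f s
    exact hf x hx
  obtain ⟨s, t, hs, ht, hst⟩ := Set.one_lt_encard_iff.1 (lt_of_le_of_lt (by norm_num) hcard)
  rcases Function.Embedding.total (privateNeighbors G S s) (privateNeighbors G S t) with
    ⟨⟨φ⟩⟩ | ⟨⟨φ⟩⟩
  exacts [(hempty hs ht hst).false φ, (hempty ht hs hst.symm).false φ]

theorem finite_criticalFreeClasses_pathGraph_three_sum (k : ℕ) :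
    (criticalFreeClasses k (pathGraph 3 ⊕g pathGraph 1)).Finite :=
  finite_criticalFreeClasses_of_indepSetFree 2 fun _ _ _ hG hfree => hG.indepSetFree_three hfree

end PathThreeSum

theorem infinite_criticalFreeClasses (h : ∀ N, ∃ (V : Type) (_ : Fintype V) (G : SimpleGraph V),
    IsVertexCritical G k ∧ IsInducedFree H G ∧ N < Fintype.card V) :
    (criticalFreeClasses k H).Infinite := by
  intro hfin
  obtain ⟨N, hN⟩ := criticalFreeClasses_finite_iff.1 hfin
  obtain ⟨V, _, G, hcrit, hfree, hlt⟩ := h N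
  exact (hN V G hcrit hfree).not_gt hlt

theorem isVertexCritical_succ_of_injective_hom (f : G →g H) (hf : Function.Injective f)
    (hG : ¬ G.Colorable n) (hH : ∀ w, (H.induce {w}ᶜ).Colorable n) :
    IsVertexCritical G (n + 1) ∧ IsVertexCritical H (n + 1) := by
  refine ⟨isVertexCritical_succ_iff.2 ⟨hG, fun v => ?_⟩,
    isVertexCritical_succ_iff.2 ⟨fun h => hG (h.of_hom f), hH⟩⟩
  let g : G.induce {v}ᶜ →g H.induce {f v}ᶜ := ⟨fun x => ⟨f x, hf.ne x.2⟩, fun h => f.map_adj h⟩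
  exact (hH (f v)).of_hom g

section Circulant

variable {A : Type*} [AddCommGroup A] [Fintype A] {s : Set A} {K I : Finset A}

theorem card_mul_card_le_of_circulantGraph (hK : (circulantGraph s).IsClique K)
    (hI : (circulantGraph s).IsIndepSet I) : K.card * I.card ≤ Fintype.card A := by
  classical
  rw [← Finset.card_product]
  refine Finset.card_le_card_of_injOn (t := .univ) (fun x => x.1 + x.2) (by simp [Set.MapsTo]) ?_
  rintro ⟨a, b⟩ hab ⟨a', b'⟩ hab' (heq : a + b = a' + b')
  obtain ⟨ha : a ∈ K, hb : b ∈ I⟩ := Finset.mem_product.1 hab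
  obtain ⟨ha' : a' ∈ K, hb' : b' ∈ I⟩ := Finset.mem_product.1 hab'
  obtain rfl | hne := eq_or_ne a a'
  · exact Prod.ext rfl (add_left_cancel heq)
  have hsub : a - a' = b' - b := by rw [sub_eq_sub_iff_add_eq_add, heq, add_comm]
  have hsub' : a' - a = b - b' := by rw [← neg_sub, hsub, neg_sub]
  have hne' : b' ≠ b := fun h => hne (sub_eq_zero.1 (by rw [hsub, h, sub_self]))
  have hadj := hK ha ha' hne
  rw [circulantGraph_adj, hsub, hsub'] at hadj
  refine absurd ?_ (hI hb' hb hne')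
  rw [circulantGraph_adj]
  exact ⟨hne', hadj.2⟩

theorem dvd_card_of_circulantGraph_colorable (hK : (circulantGraph s).IsNClique n K)
    (h : (circulantGraph s).Colorable n) : n ∣ Fintype.card A := by
  have hn : 0 < n := by
    obtain ⟨C⟩ := h
    exact (C 0).pos
  have hfree : (circulantGraph s).IndepSetFree (Fintype.card A / n + 1) := by
    rintro I ⟨hI, hcard⟩
    have hle := card_mul_card_le_of_circulantGraph hK.isClique hI
    rw [hK.card_eq, hcard] at hle
    exact (Nat.lt_mul_div_succ (Fintype.card A) hn).not_ge hle
  have hle := card_le_of_colorable_of_indepSetFree h hfree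
  exact ⟨_, ((Nat.mul_div_le _ n).antisymm (hle.trans_eq (mul_comm _ _))).symm⟩

end Circulant

/-- The `(m - 1)`-st power of the cycle of length `n`, on `ℤ/nℤ`: distinct residues are adjacent
when their difference is represented by an integer of absolute value less than `m`. These graphs and
their complements supply the large critical graphs. -/
def cyclePower (m n : ℕ) : SimpleGraph (ZMod n) :=
  circulantGraph {x | ∃ e : ℤ, |e| < m ∧ x = e}

section CyclePower

variable {p : ℕ}

theorem cyclePower_adj {x y : ZMod n} :
    (cyclePower m n).Adj x y ↔ x ≠ y ∧ ∃ e : ℤ, |e| < m ∧ x - y = e := by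
  simp only [cyclePower, circulantGraph_adj, Set.mem_ofPred_eq, and_congr_right_iff,
    or_iff_left_iff_imp]
  rintro - ⟨e, he, hxy⟩
  exact ⟨-e, by simpa using he, by rw [← neg_sub, hxy, Int.cast_neg]⟩

theorem not_colorable_cyclePower (hm : 1 < m) (hp : 0 < p) :
    ¬ (cyclePower m (m * p + 1)).Colorable m := by
  classical
  intro h
  let K : Finset (ZMod (m * p + 1)) := (Finset.range m).image (Nat.cast)
  have hlt {i : ℕ} (hi : i < m) : i < m * p + 1 := by nlinarith
  have hK : (cyclePower m (m * p + 1)).IsNClique m K := by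
    refine ⟨?_, ?_⟩
    · rintro x hx y hy hxy
      simp only [K, Finset.coe_image, Set.mem_image, Finset.coe_range, Set.mem_Iio] at hx hy
      obtain ⟨i, hi, rfl⟩ := hx
      obtain ⟨j, hj, rfl⟩ := hy
      exact cyclePower_adj.2 ⟨hxy, i - j, by rw [abs_lt]; omega, by simp⟩
    · rw [Finset.card_image_of_injOn, Finset.card_range]
      intro i hi j hj hij
      rw [Finset.coe_range, Set.mem_Iio] at hi hj
      exact Nat.ModEq.eq_of_lt_of_lt ((ZMod.natCast_eq_natCast_iff ..).1 hij) (hlt hi) (hlt hj)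
  have hdvd := dvd_card_of_circulantGraph_colorable hK h
  rw [ZMod.card, Nat.dvd_add_right (dvd_mul_right m p), Nat.dvd_one] at hdvd
  exact hm.ne' hdvd

theorem abs_sub_lt_of_div_eq {a b : ℕ} (hp : 0 < p) (h : a / p = b / p) :
    |(a - b : ℤ)| < p := by
  have ha := Nat.div_add_mod a p
  have hb := Nat.div_add_mod b p
  have := Nat.mod_lt a hp
  have := Nat.mod_lt b hp
  rw [h] at ha
  rw [abs_lt]
  omega

-- The `m * p` vertices other than `v` are cut into `m` intervals of length `p`.
theorem colorable_compl_cyclePower_induce_compl (hp : 0 < p) (v : ZMod (m * p + 1)) :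
    ((cyclePower p (m * p + 1))ᶜ.induce {v}ᶜ).Colorable m := by
  let r (x : ({v}ᶜ : Set (ZMod (m * p + 1)))) : ℕ := (x - v : ZMod (m * p + 1)).val
  have hpos x : 0 < r x := ZMod.val_pos.2 (sub_ne_zero.2 x.2)
  have hlt x : r x < m * p + 1 := ZMod.val_lt _
  refine ⟨Coloring.mk (fun x => ⟨(r x - 1) / p, ?_⟩) ?_⟩
  · exact Nat.div_lt_of_lt_mul (by grind)
  · rintro x y ⟨hne, hxy⟩ hcol
    have habs := abs_sub_lt_of_div_eq hp (Fin.mk.inj hcol)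
    rw [Nat.cast_pred (hpos x), Nat.cast_pred (hpos y), sub_sub_sub_cancel_right] at habs
    exact hxy (cyclePower_adj.2 ⟨hne, _, habs, by simp [r]⟩)

theorem not_cyclePower_adj_mul_of_adj {x y : ZMod (m * p + 1)}
    (hadj : (cyclePower m (m * p + 1)).Adj x y) :
    ¬ (cyclePower p (m * p + 1)).Adj (p * x) (p * y) := by
  intro hadj'
  obtain ⟨hne, e, he, hxy⟩ := cyclePower_adj.1 hadj
  obtain ⟨-, d, hd, hpxy⟩ := cyclePower_adj.1 hadj'
  have hdvd : ((m * p + 1 : ℕ) : ℤ) ∣ p * e - d := by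
    rw [← ZMod.intCast_zmod_eq_zero_iff_dvd]
    push_cast
    rw [← hpxy, ← hxy]
    ring
  rw [abs_lt] at he hd
  have hlt : |p * e - d| < ((m * p + 1 : ℕ) : ℤ) := by
    rw [abs_lt]
    push_cast
    constructor <;> nlinarith
  have hpe : p * e = d := sub_eq_zero.1 (Int.eq_zero_of_abs_lt_dvd hdvd hlt)
  have he0 : e = 0 := by nlinarith
  exact hne (sub_eq_zero.1 (by simp [hxy, he0]))

theorem isVertexCritical_cyclePower_and_compl (hm : 1 < m) (hp : 0 < p) :
    IsVertexCritical (cyclePower m (m * p + 1)) (m + 1) ∧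
      IsVertexCritical (cyclePower p (m * p + 1))ᶜ (m + 1) := by
  have hmp : (m * p : ZMod (m * p + 1)) = -1 := by
    rw [eq_neg_iff_add_eq_zero]
    exact_mod_cast ZMod.natCast_self (m * p + 1)
  have hinj : Function.Injective fun x : ZMod (m * p + 1) => p * x := fun x y hxy => by
    simpa [← mul_assoc, hmp] using congrArg ((m : ZMod (m * p + 1)) * ·) hxy
  let f : cyclePower m (m * p + 1) →g (cyclePower p (m * p + 1))ᶜ :=
    ⟨fun x => p * x, fun h =>
      (compl_adj ..).2 ⟨hinj.ne h.ne, not_cyclePower_adj_mul_of_adj h⟩⟩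
  exact isVertexCritical_succ_of_injective_hom f hinj (not_colorable_cyclePower hm hp)
    (colorable_compl_cyclePower_induce_compl hp)

theorem isInducedFree_cycleGraph_four_cyclePower (h : 4 * m ≤ n) :
    IsInducedFree (cycleGraph 4) (cyclePower m n) := by
  rw [IsInducedFree, cycleGraph_four_isIndContained_iff]
  rintro ⟨a, b, c, d, hac, hbd, hab, hbc, hcd, hda, hac', hbd'⟩
  obtain ⟨-, e₁, h₁, hab⟩ := cyclePower_adj.1 hab
  obtain ⟨-, e₂, h₂, hbc⟩ := cyclePower_adj.1 hbc
  obtain ⟨-, e₃, h₃, hcd⟩ := cyclePower_adj.1 hcd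
  obtain ⟨-, e₄, h₄, hda⟩ := cyclePower_adj.1 hda
  have hac' : ¬ |e₁ + e₂| < m := fun h =>
    hac' (cyclePower_adj.2 ⟨hac, _, h, by push_cast; rw [← hab, ← hbc]; ring⟩)
  have hbd' : ¬ |e₂ + e₃| < m := fun h =>
    hbd' (cyclePower_adj.2 ⟨hbd, _, h, by push_cast; rw [← hbc, ← hcd]; ring⟩)
  have hdvd : (n : ℤ) ∣ e₁ + e₂ + e₃ + e₄ := by
    rw [← ZMod.intCast_zmod_eq_zero_iff_dvd]
    push_cast
    rw [← hab, ← hbc, ← hcd, ← hda]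
    ring
  rw [abs_lt] at *
  have hsum : e₁ + e₂ + e₃ + e₄ = 0 :=
    Int.eq_zero_of_abs_lt_dvd hdvd (by rw [abs_lt]; omega)
  omega

theorem isInducedFree_starGraph_cyclePower :
    IsInducedFree (starGraph (0 : Fin 4)) (cyclePower m n) := by
  rw [IsInducedFree, starGraph_isIndContained_iff]
  rintro ⟨d, a, b, c, hda, hdb, hdc, hab, hac, hbc, hab', hac', hbc'⟩
  obtain ⟨-, e₁, h₁, hda⟩ := cyclePower_adj.1 hda
  obtain ⟨-, e₂, h₂, hdb⟩ := cyclePower_adj.1 hdb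
  obtain ⟨-, e₃, h₃, hdc⟩ := cyclePower_adj.1 hdc
  have hab' : ¬ |e₂ - e₁| < m := fun h =>
    hab' (cyclePower_adj.2 ⟨hab, _, h, by push_cast; rw [← hda, ← hdb]; ring⟩)
  have hac' : ¬ |e₃ - e₁| < m := fun h =>
    hac' (cyclePower_adj.2 ⟨hac, _, h, by push_cast; rw [← hda, ← hdc]; ring⟩)
  have hbc' : ¬ |e₃ - e₂| < m := fun h =>
    hbc' (cyclePower_adj.2 ⟨hbc, _, h, by push_cast; rw [← hdb, ← hdc]; ring⟩)
  rw [abs_lt] at *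
  omega

theorem cliqueFree_three_cyclePower_two (hn : 3 < n) : (cyclePower 2 n).CliqueFree 3 := by
  intro s hs
  obtain ⟨a, b, c, hab, hac, hbc, -⟩ := is3Clique_iff.1 hs
  obtain ⟨hab, e₁, h₁, hab'⟩ := cyclePower_adj.1 hab
  obtain ⟨hbc, e₂, h₂, hbc'⟩ := cyclePower_adj.1 hbc
  obtain ⟨hac, e₃, h₃, hac'⟩ := cyclePower_adj.1 hac
  have he₁ : e₁ ≠ 0 := fun h => hab (sub_eq_zero.1 (by simp [hab', h]))
  have he₂ : e₂ ≠ 0 := fun h => hbc (sub_eq_zero.1 (by simp [hbc', h]))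
  have he₃ : e₃ ≠ 0 := fun h => hac (sub_eq_zero.1 (by simp [hac', h]))
  have hdvd : (n : ℤ) ∣ e₁ + e₂ - e₃ := by
    rw [← ZMod.intCast_zmod_eq_zero_iff_dvd]
    push_cast
    rw [← hab', ← hbc', ← hac']
    ring
  rw [abs_lt] at *
  have hsum : e₁ + e₂ - e₃ = 0 := Int.eq_zero_of_abs_lt_dvd hdvd (by rw [abs_lt]; omega)
  omega

end CyclePower

theorem infinite_criticalFreeClasses_cycleGraph_four (hm : 1 < m) :
    (criticalFreeClasses (m + 1) (cycleGraph 4)).Infinite :=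
  infinite_criticalFreeClasses fun N =>
    ⟨_, inferInstance, _, (isVertexCritical_cyclePower_and_compl hm (Nat.succ_pos (N + 3))).1,
      isInducedFree_cycleGraph_four_cyclePower (by grind), by rw [ZMod.card]; nlinarith⟩

theorem infinite_criticalFreeClasses_starGraph (hm : 1 < m) :
    (criticalFreeClasses (m + 1) (starGraph (0 : Fin 4))).Infinite :=
  infinite_criticalFreeClasses fun N =>
    ⟨_, inferInstance, _, (isVertexCritical_cyclePower_and_compl hm N.succ_pos).1,
      isInducedFree_starGraph_cyclePower, by rw [ZMod.card]; nlinarith⟩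

theorem isInducedFree_compl_of_isInducedFree_cycleGraph_four
    (h : IsInducedFree (cycleGraph 4) G) : IsInducedFree (pathGraph 2 ⊕g pathGraph 2) Gᶜ := by
  have hcycle : cycleGraph 4 ⊴ (pathGraph 2 ⊕g pathGraph 2)ᶜ :=
    cycleGraph_four_isIndContained_iff.2
      ⟨.inl 0, .inr 0, .inl 1, .inr 1, by simp [pathGraph_adj]⟩
  rw [IsInducedFree, ← compl_isIndContained_compl, compl_compl]
  exact fun hG => h (hcycle.trans hG)

theorem infinite_criticalFreeClasses_pathGraph_two_sum_pathGraph_two (hm : 4 ≤ m) :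
    (criticalFreeClasses (m + 1) (pathGraph 2 ⊕g pathGraph 2)).Infinite := by
  refine infinite_criticalFreeClasses fun N => ⟨_, inferInstance, _,
    (isVertexCritical_cyclePower_and_compl (by omega) N.succ_pos).2,
    isInducedFree_compl_of_isInducedFree_cycleGraph_four
      (isInducedFree_cycleGraph_four_cyclePower ?_), ?_⟩
  · exact (Nat.mul_le_mul_right _ hm).trans (Nat.le_succ _)
  · rw [ZMod.card]
    nlinarith

/-- The Mycielskian of `G`: besides the vertices `some (inl x)` of `G` there is a copy
`some (inr x)` of each of them, adjacent to the neighbours of `x` in `G` and to the apex `none`.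
It raises the chromatic number without creating triangles. -/
def mycielskian (G : SimpleGraph V) : SimpleGraph (Option (V ⊕ V)) where
  Adj
    | some (.inl x), some (.inl y) => G.Adj x y
    | some (.inl x), some (.inr y) => G.Adj x y
    | some (.inr x), some (.inl y) => G.Adj x y
    | some (.inr _), none => True
    | none, some (.inr _) => True
    | _, _ => False
  symm := ⟨by rintro (_ | _ | _) (_ | _ | _) h <;> first | exact h | exact h.symm⟩
  loopless := ⟨by rintro (_ | _ | _) h; exacts [h, G.loopless.irrefl _ h, h]⟩

section Mycielskian

theorem adj_elim_of_mycielskian_adj {a b : V ⊕ V} (h : (mycielskian G).Adj (some a) (some b)) :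
    G.Adj (Sum.elim id id a) (Sum.elim id id b) := by
  rcases a with x | x <;> rcases b with y | y
  exacts [h, h, h, h.elim]

theorem not_mycielskian_adj_none_adj_none {a b : V ⊕ V} (ha : (mycielskian G).Adj none (some a))
    (hb : (mycielskian G).Adj none (some b)) : ¬ (mycielskian G).Adj (some a) (some b) := by
  rcases a with x | x <;> rcases b with y | y
  exacts [ha.elim, ha.elim, hb.elim, id]

theorem cliqueFree_three_mycielskian (hG : G.CliqueFree 3) : (mycielskian G).CliqueFree 3 := by
  classical
  intro s hs
  obtain ⟨a, b, c, hab, hac, hbc, -⟩ := is3Clique_iff.1 hs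
  rcases a with _ | a <;> rcases b with _ | b <;> rcases c with _ | c
  case some.some.some =>
    exact hG _ (is3Clique_iff.2 ⟨_, _, _, adj_elim_of_mycielskian_adj hab,
      adj_elim_of_mycielskian_adj hac, adj_elim_of_mycielskian_adj hbc, rfl⟩)
  case none.some.some => exact not_mycielskian_adj_none_adj_none hab hac hbc
  case some.none.some => exact not_mycielskian_adj_none_adj_none hab.symm hbc hac
  case some.some.none => exact not_mycielskian_adj_none_adj_none hac.symm hbc.symm hab
  all_goals simp_all

theorem colorable_of_colorable_mycielskian (h : (mycielskian G).Colorable (n + 1)) :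
    G.Colorable n := by
  classical
  obtain ⟨C⟩ := h
  let c (x : V) : Fin (n + 1) :=
    if C (some (.inl x)) = C none then C (some (.inr x)) else C (some (.inl x))
  have hc (x : V) : c x ≠ C none := by
    have : (mycielskian G).Adj (some (.inr x)) none := trivial
    grind [C.valid this]
  let D : G.Coloring {i // i ≠ C none} := Coloring.mk (fun x => ⟨c x, hc x⟩) fun {x y} hxy => by
    have hll : (mycielskian G).Adj (some (.inl x)) (some (.inl y)) := hxy
    have hlr : (mycielskian G).Adj (some (.inl x)) (some (.inr y)) := hxy
    have hrl : (mycielskian G).Adj (some (.inr x)) (some (.inl y)) := hxy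
    grind [C.valid hll, C.valid hlr, C.valid hrl]
  simpa using D.colorable

theorem colorable_mycielskian_induce_compl_none (hG : G.Colorable n) :
    ((mycielskian G).induce {none}ᶜ).Colorable n := by
  let f : (mycielskian G).induce {none}ᶜ →g G :=
    { toFun
        | ⟨some a, _⟩ => Sum.elim id id a
        | ⟨none, h⟩ => (h rfl).elim
      map_rel' := by
        rintro ⟨_ | a, ha⟩ ⟨_ | b, hb⟩ hab
        exacts [(ha rfl).elim, (ha rfl).elim, (hb rfl).elim, adj_elim_of_mycielskian_adj hab] }
  exact hG.of_hom f

theorem colorable_mycielskian_induce_compl_inl {x : V} (hn : 0 < n)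
    (C : G.Coloring (Option (Fin n))) (hC : ∀ y, C y = none → y = x) :
    ((mycielskian G).induce {some (.inl x)}ᶜ).Colorable (n + 1) := by
  let c : Option (V ⊕ V) → Option (Fin n)
    | some (.inl y) => C y
    | some (.inr _) => none
    | none => some ⟨0, hn⟩
  let D : ((mycielskian G).induce {some (.inl x)}ᶜ).Coloring (Option (Fin n)) :=
    Coloring.mk (fun a => c a) <| by
      rintro ⟨_ | y | y, ha⟩ ⟨_ | z | z, hb⟩ hab
      · exact hab.elim
      · exact hab.elim
      · exact Option.some_ne_none _
      · exact hab.elim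
      · exact C.valid hab
      · exact fun h => ha (congrArg _ (congrArg _ (hC y h)))
      · exact (Option.some_ne_none _).symm
      · exact fun h => hb (congrArg _ (congrArg _ (hC z h.symm)))
      · exact hab.elim
  simpa using D.colorable

theorem colorable_mycielskian_induce_compl_inr {x : V}
    (C : G.Coloring (Option (Fin n))) (hC : ∀ y, C y = none → y = x) :
    ((mycielskian G).induce {some (.inr x)}ᶜ).Colorable (n + 1) := by
  let c : Option (V ⊕ V) → Option (Fin n)
    | some a => C (Sum.elim id id a)
    | none => none
  let D : ((mycielskian G).induce {some (.inr x)}ᶜ).Coloring (Option (Fin n)) :=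
    Coloring.mk (fun a => c a) <| by
      rintro ⟨_ | a, ha⟩ ⟨_ | b, hb⟩ hab
      · exact hab.elim
      · rcases b with y | y
        · exact hab.elim
        · exact fun h => hb (congrArg _ (congrArg _ (hC y h.symm)))
      · rcases a with y | y
        · exact hab.elim
        · exact fun h => ha (congrArg _ (congrArg _ (hC y h)))
      · exact C.valid (adj_elim_of_mycielskian_adj hab)
  simpa using D.colorable

theorem isVertexCritical_mycielskian (hn : 0 < n) (hG : IsVertexCritical G (n + 1)) :
    IsVertexCritical (mycielskian G) (n + 2) := by
  rw [isVertexCritical_succ_iff]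
  refine ⟨fun h => (isVertexCritical_succ_iff.1 hG).1 (colorable_of_colorable_mycielskian h), ?_⟩
  have hdel (x : V) : ∃ C : G.Coloring (Option (Fin n)), ∀ y, C y = none ↔ y = x :=
    exists_coloring_option_of_induce_compl (Set.pairwise_singleton x _)
      ((isVertexCritical_succ_iff.1 hG).2 x)
  rintro (_ | x | x)
  · exact colorable_mycielskian_induce_compl_none hG.colorable
  · obtain ⟨C, hC⟩ := hdel x
    exact colorable_mycielskian_induce_compl_inl hn C fun y => (hC y).1
  · obtain ⟨C, hC⟩ := hdel x
    exact colorable_mycielskian_induce_compl_inr C fun y => (hC y).1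

end Mycielskian

theorem exists_isVertexCritical_cliqueFree_three (hm : 2 ≤ m) (N : ℕ) :
    ∃ (V : Type) (_ : Fintype V) (G : SimpleGraph V),
      IsVertexCritical G (m + 1) ∧ G.CliqueFree 3 ∧ N < Fintype.card V := by
  induction m, hm using Nat.le_induction with
  | base =>
    exact ⟨_, inferInstance, _,
      (isVertexCritical_cyclePower_and_compl one_lt_two (Nat.succ_pos (N + 1))).1,
      cliqueFree_three_cyclePower_two (by omega), by rw [ZMod.card]; omega⟩
  | succ m hm ih =>
    obtain ⟨V, _, G, hcrit, hfree, hcard⟩ := ih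
    refine ⟨_, inferInstance, mycielskian G, isVertexCritical_mycielskian (by omega) hcrit,
      cliqueFree_three_mycielskian hfree, ?_⟩
    simp only [Fintype.card_option, Fintype.card_sum]
    omega

theorem infinite_criticalFreeClasses_completeGraph_three (hm : 2 ≤ m) :
    (criticalFreeClasses (m + 1) (completeGraph (Fin 3))).Infinite :=
  infinite_criticalFreeClasses fun N => by
    simpa only [isInducedFree_completeGraph_iff] using exists_isVertexCritical_cliqueFree_three hm N

section Classification

theorem isIndContained_of_card_le [Finite V] (h : H ⊴ G) (hcard : Nat.card V ≤ Nat.card W) :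
    G ⊴ H := by
  obtain ⟨f⟩ := h
  have hbij : Function.Bijective f := f.injective.bijective_of_nat_card_le hcard
  exact ⟨(RelIso.ofSurjective f hbij.surjective).symm.toRelEmbedding⟩

theorem isIndContained_of_isIndContained_map {T : SimpleGraph U} (hT : ∀ x, ∃ y, T.Adj x y)
    (f : V ↪ W) (h : T ⊴ G.map f) : T ⊴ G := by
  obtain ⟨g⟩ := h
  have hrange (x : U) : ∃ v, f v = g x := by
    obtain ⟨y, hxy⟩ := hT x
    obtain ⟨v, -, -, hv, -⟩ := (map_adj f G _ _).1 (g.map_adj_iff.2 hxy)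
    exact ⟨v, hv⟩
  choose p hp using hrange
  refine ⟨⟨⟨p, fun x y hxy => g.injective ?_⟩, fun {x y} => ?_⟩⟩
  · rw [← hp, ← hp, hxy]
  · change G.Adj (p x) (p y) ↔ T.Adj x y
    rw [← g.map_adj_iff, ← hp, ← hp, map_adj_apply]

theorem pathGraph_four_or_pathGraph_three_sum_isIndContained {a b c d : V} (htri : G.CliqueFree 3)
    (hcycle : IsInducedFree (cycleGraph 4) G) (hstar : IsInducedFree (starGraph (0 : Fin 4)) G)
    (hab : G.Adj a b) (hbc : G.Adj b c) (hac : a ≠ c) (had : a ≠ d) (hbd : b ≠ d) (hcd : c ≠ d) :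
    pathGraph 4 ⊴ G ∨ pathGraph 3 ⊕g pathGraph 1 ⊴ G := by
  classical
  have htri' {x y z : V} (hxy : G.Adj x y) (hyz : G.Adj y z) : ¬ G.Adj x z := fun hxz =>
    htri _ (is3Clique_triple_iff.2 ⟨hxy, hxz, hyz⟩)
  have hac' : ¬ G.Adj a c := htri' hab hbc
  have hbd' : ¬ G.Adj b d := fun h => hstar <| starGraph_isIndContained_iff.2
    ⟨b, a, c, d, hab.symm, hbc, h, hac, had, hcd, hac', htri' hab h, htri' hbc.symm h⟩
  by_cases had' : G.Adj a d <;> by_cases hcd' : G.Adj c d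
  · exact absurd (cycleGraph_four_isIndContained_iff.2
      ⟨a, b, c, d, hac, hbd, hab, hbc, hcd', had'.symm, hac', hbd'⟩) hcycle
  · exact .inl (pathGraph_four_isIndContained had'.symm hab hbc
      (fun h => hbd' h.symm) (fun h => hcd' h.symm) hac')
  · exact .inl (pathGraph_four_isIndContained hab hbc hcd' hac' had' hbd')
  · exact .inr (pathGraph_three_sum_isIndContained hab hbc hac hac' had' hbd' hcd')

theorem pathGraph_two_sum_isIndContained_of_forall_eq {a b c d : V}
    (hmatch : IsInducedFree (pathGraph 2 ⊕g pathGraph 2) G)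
    (hpath : ∀ x y z, G.Adj x y → G.Adj y z → x = z) (hab : G.Adj a b)
    (hac : a ≠ c) (had : a ≠ d) (hbc : b ≠ c) (hbd : b ≠ d) (hcd : c ≠ d) :
    pathGraph 2 ⊕g (pathGraph 1 ⊕g pathGraph 1) ⊴ G := by
  have hac' : ¬ G.Adj a c := fun h => hbc (hpath b a c hab.symm h)
  have had' : ¬ G.Adj a d := fun h => hbd (hpath b a d hab.symm h)
  have hbc' : ¬ G.Adj b c := fun h => hac (hpath a b c hab h)
  have hbd' : ¬ G.Adj b d := fun h => had (hpath a b d hab h)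
  have hcd' : ¬ G.Adj c d := fun h =>
    hmatch (pathGraph_two_sum_pathGraph_two_isIndContained hab h hac' had' hbc' hbd')
  exact pathGraph_two_sum_isIndContained hab hcd hcd' hac' had' hbc' hbd'

theorem isIndContained_of_card_eq_four (hV : Nat.card V = 4)
    (htri : IsInducedFree (completeGraph (Fin 3)) G) (hcycle : IsInducedFree (cycleGraph 4) G)
    (hstar : IsInducedFree (starGraph (0 : Fin 4)) G)
    (hmatch : IsInducedFree (pathGraph 2 ⊕g pathGraph 2) G) :
    G ⊴ (completeGraph (Fin 4))ᶜ ∨ G ⊴ pathGraph 4 ∨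
      G ⊴ pathGraph 2 ⊕g (pathGraph 1 ⊕g pathGraph 1) ∨ G ⊴ pathGraph 3 ⊕g pathGraph 1 := by
  classical
  have : Finite V := Nat.finite_of_card_ne_zero (by omega)
  have : Fintype V := Fintype.ofFinite V
  have hout {s : Finset V} (hs : s.card ≤ 3) : ∃ x, x ∉ s := by
    by_contra! h
    rw [Finset.eq_univ_of_forall h, Finset.card_univ, ← Nat.card_eq_fintype_card] at hs
    omega
  by_cases hpath : ∀ x y z, G.Adj x y → G.Adj y z → x = z
  · by_cases hedge : ∃ a b, G.Adj a b
    · obtain ⟨a, b, hab⟩ := hedge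
      obtain ⟨c, hc⟩ := hout (s := {a, b}) (Finset.card_le_two.trans (by omega))
      obtain ⟨d, hd⟩ := hout (s := {a, b, c}) Finset.card_le_three
      simp only [Finset.mem_insert, Finset.mem_singleton, not_or, ← ne_eq] at hc hd
      exact .inr <| .inr <| .inl <| isIndContained_of_card_le
        (pathGraph_two_sum_isIndContained_of_forall_eq hmatch hpath hab hc.1.symm hd.1.symm
          hc.2.symm hd.2.1.symm hd.2.2.symm) (hV.le.trans (by simp))
    · push Not at hedge
      exact .inl ⟨⟨(Finite.equivFinOfCardEq hV).toEmbedding, by simp [hedge]⟩⟩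
  · push Not at hpath
    obtain ⟨a, b, c, hab, hbc, hac⟩ := hpath
    obtain ⟨d, hd⟩ := hout (s := {a, b, c}) Finset.card_le_three
    simp only [Finset.mem_insert, Finset.mem_singleton, not_or, ← ne_eq] at hd
    rcases pathGraph_four_or_pathGraph_three_sum_isIndContained
      (isInducedFree_completeGraph_iff.1 htri) hcycle hstar hab hbc hac hd.1.symm hd.2.1.symm
      hd.2.2.symm with h | h
    · exact .inr <| .inl <| isIndContained_of_card_le h (hV.le.trans (by simp))
    · exact .inr <| .inr <| .inr <| isIndContained_of_card_le h (hV.le.trans (by simp))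

theorem isIndContained_of_card_le_four [Finite V] (hV : Nat.card V ≤ 4)
    (htri : IsInducedFree (completeGraph (Fin 3)) G) (hcycle : IsInducedFree (cycleGraph 4) G)
    (hstar : IsInducedFree (starGraph (0 : Fin 4)) G)
    (hmatch : IsInducedFree (pathGraph 2 ⊕g pathGraph 2) G) :
    G ⊴ (completeGraph (Fin 4))ᶜ ∨ G ⊴ pathGraph 4 ∨
      G ⊴ pathGraph 2 ⊕g (pathGraph 1 ⊕g pathGraph 1) ∨ G ⊴ pathGraph 3 ⊕g pathGraph 1 := by
  obtain ⟨f⟩ : Nonempty (V ↪ Fin 4) := by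
    have := Fintype.ofFinite V
    exact Function.Embedding.nonempty_of_card_le (by simpa [Nat.card_eq_fintype_card] using hV)
  have hGf : G ⊴ G.map f := ⟨Embedding.map f G⟩
  have hfree {X : Type} {T : SimpleGraph X} (hT : ∀ x, ∃ y, T.Adj x y) (h : IsInducedFree T G) :
      IsInducedFree T (G.map f) :=
    fun hmap => h (isIndContained_of_isIndContained_map hT f hmap)
  refine (isIndContained_of_card_eq_four (Nat.card_fin 4) (hfree (by decide) htri)
    (hfree (by decide) hcycle) (hfree (by decide) hstar) (hfree ?_ hmatch)).imp
    hGf.trans (Or.imp hGf.trans (Or.imp hGf.trans hGf.trans))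
  simp [Sum.forall, Fin.forall_fin_two, pathGraph_adj]

end Classification

end

theorem theorem1 {V : Type*} [Finite V] (H : SimpleGraph V) (hH : Nat.card V ≤ 4)
    (k : ℕ) (hk : 5 ≤ k) :
    (criticalFreeClasses k H).Finite ↔
      (H ⊴ (SimpleGraph.completeGraph (Fin 4))ᶜ ∨
        H ⊴ SimpleGraph.pathGraph 4 ∨
        H ⊴ (SimpleGraph.pathGraph 2 ⊕g (SimpleGraph.pathGraph 1 ⊕g SimpleGraph.pathGraph 1)) ∨
        H ⊴ (SimpleGraph.pathGraph 3 ⊕g SimpleGraph.pathGraph 1)) := by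
  obtain ⟨m, rfl⟩ : ∃ m, k = m + 1 := ⟨k - 1, by omega⟩
  refine ⟨fun hfin => ?_, ?_⟩
  · have hfree {X : Type} {T : SimpleGraph X} (hT : (criticalFreeClasses (m + 1) T).Infinite) :
        IsInducedFree T H :=
      fun h => hT (hfin.subset (criticalFreeClasses_mono h))
    exact isIndContained_of_card_le_four hH
      (hfree (infinite_criticalFreeClasses_completeGraph_three (by omega)))
      (hfree (infinite_criticalFreeClasses_cycleGraph_four (by omega)))
      (hfree (infinite_criticalFreeClasses_starGraph (by omega)))
      (hfree (infinite_criticalFreeClasses_pathGraph_two_sum_pathGraph_two (by omega)))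
  · rintro (h | h | h | h)
    · exact (finite_criticalFreeClasses_compl_completeGraph 3 _).subset (criticalFreeClasses_mono h)
    · exact (finite_criticalFreeClasses_pathGraph_four _).subset (criticalFreeClasses_mono h)
    · exact (finite_criticalFreeClasses_pathGraph_two_sum _).subset (criticalFreeClasses_mono h)
    · exact (finite_criticalFreeClasses_pathGraph_three_sum _).subset (criticalFreeClasses_mono h)
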